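/- Fix integers $k \ge 0$, $d \ge 1$ and a noise level $\sigma > 0$, and put $s = (k+1)/d$. For $n = N^d$, index the coordinates of vectors in $\mathbb{R}^n$ by the lattice $\{1/N, 2/N, \ldots, 1\}^d$. For $m \ge 1$ let $D_m \in \mathbb{R}^{(m-1)\times m}$ be the first-difference matrix, $(D_m v)_i = v_{i+1} - v_i$; put $D^{(1)}_N = D_N$ and $D^{(r+1)}_N = D_{N-r} D^{(r)}_N$ for $r \ge 1$, so that $D^{(k+1)}_N \in \mathbb{R}^{(N-k-1)\times N}$. Let $D^{(k+1)}_{n,d}$ be the matrix obtained by stacking the $d$ blocks $I_N \otimes \cdots \otimes D^{(k+1)}_N \otimes \cdots \otimes I_N$ ($d$ factors, with $D^{(k+1)}_N$ in position $j = 1, \ldots, d$), and let $$\mathcal{T}^k_{n,d}(\rho) = \{\theta \in \mathbb{R}^n : \|D^{(k+1)}_{n,d}\,\theta\|_1 \le \rho\}, \qquad \rho > 0,$$ be the Kronecker total variation (KTV) class. Given observations $y_i \sim N(\theta_{0,i}, \sigma^2)$, independent for $i = 1, \ldots, n$, let $$R(\mathcal{K}) = \inf_{\hat\theta}\ \sup_{\theta_0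 \in \mathcal{K}}\ \frac{1}{n}\,\mathbb{E}\,\|\hat\theta(y) - \theta_0\|_2^2$$ be the minimax risk over $\mathcal{K} \subseteq \mathbb{R}^n$, the infimum being over all measurable estimators $\hat\theta : \mathbb{R}^n \to \mathbb{R}^n$. Then for any sequence $0 < C_n \le n$, $$R\big(\mathcal{T}^k_{n,d}(C_n)\big) = \Omega\left(\frac{1}{n} + \frac{C_n}{n} + \Big(\frac{C_n}{n}\Big)^{\frac{2}{2s+1}}\right) \qquad (n = N^d \to \infty).$$ That is, there is a constant $c > 0$, depending only on $k$, $d$ and $\sigma$, such that for all sufficiently large $N$, with $n = N^d$, and all $C_n$ with $0 < C_n \le n$, the left-hand side is at least $c$ times the expression in parentheses. -/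

import Mathlib

open Filter MeasureTheory ProbabilityTheory
open scoped NNReal ENNReal

noncomputable section

/-- The first order difference matrix on `m` points, of size `(m - 1) × m`: row `i` has the entry
`-1` in column `i`, the entry `1` in column `i + 1`, and zeros elsewhere. -/
def diffMat (m : ℕ) : Matrix (Fin (m - 1)) (Fin m) ℝ :=
  Matrix.of fun i j =>
    if (j : ℕ) = (i : ℕ) + 1 then 1 else if (j : ℕ) = (i : ℕ) then -1 else 0

/-- The difference matrix of order `r` on `N` points, of size `(N - r) × N`, defined by the
recursion `D^(r+1)_N = D_(N-r) * D^(r)_N`, started at the identity (so that `D^(1)_N = D_N`).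
If `N ≤ r`, it has no rows. -/
def diffMatOrder (N : ℕ) : (r : ℕ) → Matrix (Fin (N - r)) (Fin N) ℝ
  | 0 => (1 : Matrix (Fin N) (Fin N) ℝ)
  | r + 1 => diffMat (N - r) * diffMatOrder N r

/-- The rows of the Kronecker penalty matrix: the block `j`, and in this block a row index of
`D^(k+1)_N` for the `j`-th tensor factor together with a row index of the identity `I_N` for every
other factor. -/
abbrev KtvRow (k N d : ℕ) : Type :=
  Σ j : Fin d, Fin (N - (k + 1)) × ({l : Fin d // l ≠ j} → Fin N)

/-- The Kronecker penalty matrix. Columns are indexed by the lattice points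
`((x 0 + 1) / N, …, (x (d - 1) + 1) / N)`, with `x : Fin d → Fin N`. The block `j` is the Kronecker
product of `d` matrices, of which the `j`-th is `D^(k+1)_N` and all the others are `I_N`. -/
def ktvMat (k N d : ℕ) : Matrix (KtvRow k N d) (Fin d → Fin N) ℝ :=
  Matrix.of fun r x =>
    diffMatOrder N (k + 1) r.2.1 (x r.1) *
      ∏ l : {l : Fin d // l ≠ r.1}, (1 : Matrix (Fin N) (Fin N) ℝ) (r.2.2 l) (x l)

/-- The Kronecker total variation of order `k` of a vector on the lattice: the `ℓ₁` norm of its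
image under the Kronecker penalty matrix. -/
def ktv (k N d : ℕ) (θ : (Fin d → Fin N) → ℝ) : ℝ :=
  ∑ r : KtvRow k N d, |(ktvMat k N d).mulVec θ r|

/-- The Kronecker total variation class of order `k` and radius `ρ`, in dimension `n = N ^ d`. -/
def ktvClass (k N d : ℕ) (ρ : ℝ) : Set ((Fin d → Fin N) → ℝ) :=
  {θ | ktv k N d θ ≤ ρ}

/-- The law of the observations: independent `y i ∼ N(θ i, σ²)`. -/
def normalMeans {ι : Type*} [Fintype ι] (σ : ℝ≥0) (θ : ι → ℝ) : Measure (ι → ℝ) :=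
  Measure.pi fun i => gaussianReal (θ i) (σ ^ 2)

/-- The risk `(1 / n) E ‖est(y) - θ‖₂²` of the estimator `est` at the mean vector `θ`, where `n` is
the number of observations. -/
def sqRisk {ι : Type*} [Fintype ι] (σ : ℝ≥0) (est : (ι → ℝ) → (ι → ℝ)) (θ : ι → ℝ) : ℝ≥0∞ :=
  (Fintype.card ι : ℝ≥0∞)⁻¹ *
    ∫⁻ y, ENNReal.ofReal (∑ i, (est y i - θ i) ^ 2) ∂(normalMeans σ θ)

/-- The minimax risk over a set `K` of mean vectors: the infimum over all (measurable) estimators of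
the supremum over `K` of the risk. -/
def minimaxRiskOn {ι : Type*} [Fintype ι] (σ : ℝ≥0) (K : Set (ι → ℝ)) : ℝ≥0∞ :=
  ⨅ (est : (ι → ℝ) → (ι → ℝ)) (_ : Measurable est), ⨆ θ ∈ K, sqRisk σ est θ

end

/-! Each of the three terms is a lower bound on its own, and a sum of three is at most three times
their maximum. All three come from Assouad's method (`assouad_bound`): attach independent signs to
vectors with disjoint supports, each of squared norm at most `σ² / 4`. No sign can then be detected,
so the risk is at least a constant times the total squared norm over `n`. It remains to choose
vectors of small Kronecker variation. Constants have variation zero and give `1 / n`. About `C` unit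
spikes, each of variation `O(1)`, give `C / n`. The last term uses products of discrete B-splines on
cubes of side of order `h`. The univariate bump has generating polynomial `(1 + X + ⋯ + X ^ (h - 1))
^ (k + 1)`. Differencing is multiplication by `1 - X`, so its difference of order `k + 1` is `(1 - X
^ h) ^ (k + 1)`, of `ℓ₁` norm at most `2 ^ (k + 1)`. Its own `ℓ₁` norm is at most `h ^ (k + 1)`, and
its squared `ℓ₂` norm is at least of order `h ^ (2k + 1)`. With products scaled to squared norm `σ²
/ 4` and about `(N / h) ^ d` cubes, the total variation is of order `n h ^ (-(k + 1) - d / 2)`. It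
is at most `C` once `h ^ (2(k + 1) + d)` exceeds a multiple of `(n / C)²`, and the resulting risk `h
^ (-d)` is then of order `(C / n) ^ (2 / (2s + 1))`. -/

/-! ### Gaussian likelihood ratios and product densities. -/

/-- The density of `N(b, v)` with respect to `N(a, v)`. -/
noncomputable def gaussianRatio (v : ℝ≥0) (a b x : ℝ) : ℝ≥0∞ :=
  ENNReal.ofReal (Real.exp ((2 * (b - a) * x - b ^ 2 + a ^ 2) / (2 * v)))

lemma measurable_gaussianRatio (v : ℝ≥0) (a b : ℝ) : Measurable (gaussianRatio v a b) := by
  unfold gaussianRatio; fun_prop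

lemma gaussianReal_eq_withDensity_gaussianRatio {v : ℝ≥0} (hv : v ≠ 0) (a b : ℝ) :
    gaussianReal b v = (gaussianReal a v).withDensity (gaussianRatio v a b) := by
  rw [gaussianReal_of_var_ne_zero _ hv, gaussianReal_of_var_ne_zero _ hv,
    ← withDensity_mul _ (measurable_gaussianPDF _ _) (measurable_gaussianRatio _ _ _)]
  congr 1
  ext x
  have hv' : (v : ℝ) ≠ 0 := by exact_mod_cast hv
  simp only [gaussianPDF, gaussianPDFReal, Pi.mul_apply, gaussianRatio]
  rw [← ENNReal.ofReal_mul (by positivity), mul_assoc _ (Real.exp _) (Real.exp _),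
    ← Real.exp_add]
  congr 3
  field_simp
  ring

lemma lintegral_gaussianRatio {v : ℝ≥0} (hv : v ≠ 0) (a b : ℝ) :
    ∫⁻ x, gaussianRatio v a b x ∂(gaussianReal a v) = 1 := by
  rw [← setLIntegral_univ, ← withDensity_apply _ MeasurableSet.univ,
    ← gaussianReal_eq_withDensity_gaussianRatio hv, measure_univ]

/-- Completing the square: the squared ratio from `a` to `b` is a constant times the ratio from `a`
to `2 * b - a`, which integrates to one. -/
lemma lintegral_gaussianRatio_sq {v : ℝ≥0} (hv : v ≠ 0) (a b : ℝ) :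
    ∫⁻ x, gaussianRatio v a b x ^ 2 ∂(gaussianReal a v)
      = ENNReal.ofReal (Real.exp ((b - a) ^ 2 / v)) := by
  have hv' : (v : ℝ) ≠ 0 := by exact_mod_cast hv
  have h : ∀ x, gaussianRatio v a b x ^ 2
      = ENNReal.ofReal (Real.exp ((b - a) ^ 2 / v)) * gaussianRatio v a (2 * b - a) x := by
    intro x
    rw [gaussianRatio, gaussianRatio, ← ENNReal.ofReal_pow (by positivity),
      ← ENNReal.ofReal_mul (by positivity), ← Real.exp_nat_mul, ← Real.exp_add]
    congr 2
    field_simp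
    push_cast
    ring
  simp_rw [h]
  rw [lintegral_const_mul _ (measurable_gaussianRatio _ _ _), lintegral_gaussianRatio hv, mul_one]

section Product

variable {ι : Type*} [Fintype ι] {X : ι → Type*} [∀ i, MeasurableSpace (X i)]

lemma lintegral_pi_prod (μ : ∀ i, Measure (X i)) [∀ i, IsProbabilityMeasure (μ i)]
    {f : ∀ i, X i → ℝ≥0∞} (hf : ∀ i, Measurable (f i)) :
    ∫⁻ y, ∏ i, f i (y i) ∂(Measure.pi μ) = ∏ i, ∫⁻ x, f i x ∂(μ i) := by
  have h := lintegral_prod_eq_prod_lintegral_of_indepFun (μ := Measure.pi μ) Finset.univ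
    (fun i (y : ∀ i, X i) => f i (y i)) (iIndepFun_pi fun i => (hf i).aemeasurable)
    (fun i => (hf i).comp (measurable_pi_apply i))
  rw [h]
  refine Finset.prod_congr rfl fun i _ => ?_
  exact (measurePreserving_eval μ i).lintegral_comp (hf i)

lemma pi_withDensity (μ : ∀ i, Measure (X i)) [∀ i, IsProbabilityMeasure (μ i)]
    {f : ∀ i, X i → ℝ≥0∞} (hf : ∀ i, Measurable (f i))
    [∀ i, SigmaFinite ((μ i).withDensity (f i))] :
    Measure.pi (fun i => (μ i).withDensity (f i))
      = (Measure.pi μ).withDensity (fun y => ∏ i, f i (y i)) := by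
  refine Measure.pi_eq fun s hs => ?_
  rw [withDensity_apply _ (MeasurableSet.univ_pi hs),
    ← lintegral_indicator (MeasurableSet.univ_pi hs)]
  have : ∀ y : ∀ i, X i, (Set.univ.pi s).indicator (fun y => ∏ i, f i (y i)) y
      = ∏ i, (s i).indicator (f i) (y i) := by
    intro y
    by_cases hy : y ∈ Set.univ.pi s
    · rw [Set.indicator_of_mem hy]
      exact Finset.prod_congr rfl fun i _ => (Set.indicator_of_mem (hy i trivial) _).symm
    · rw [Set.indicator_of_notMem hy]
      simp only [Set.mem_pi, Set.mem_univ, true_implies, not_forall] at hy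
      obtain ⟨i, hi⟩ := hy
      exact (Finset.prod_eq_zero (Finset.mem_univ i) (Set.indicator_of_notMem hi _)).symm
  simp_rw [this]
  rw [lintegral_pi_prod μ fun i => (hf i).indicator (hs i)]
  refine Finset.prod_congr rfl fun i _ => ?_
  rw [lintegral_indicator (hs i), withDensity_apply _ (hs i)]

end Product

/-! ### Le Cam's and Assouad's bounds. -/

section TwoPoint

variable {ι : Type*} [Fintype ι]

instance (σ : ℝ≥0) (θ : ι → ℝ) : IsProbabilityMeasure (normalMeans σ θ) := by
  unfold normalMeans; infer_instance

lemma normalMeans_eq_withDensity {σ : ℝ≥0} (hσ : 0 < σ) (θ η : ι → ℝ) :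
    normalMeans σ η = (normalMeans σ θ).withDensity
      (fun y => ∏ i, gaussianRatio (σ ^ 2) (θ i) (η i) (y i)) := by
  have hv : σ ^ 2 ≠ 0 := by positivity
  have h : ∀ i, (gaussianReal (θ i) (σ ^ 2)).withDensity (gaussianRatio (σ ^ 2) (θ i) (η i))
      = gaussianReal (η i) (σ ^ 2) :=
    fun i => (gaussianReal_eq_withDensity_gaussianRatio hv _ _).symm
  have : ∀ i, SigmaFinite ((gaussianReal (θ i) (σ ^ 2)).withDensity
      (gaussianRatio (σ ^ 2) (θ i) (η i))) := fun i => by rw [h]; infer_instance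
  rw [normalMeans, normalMeans, ← pi_withDensity _ fun i => measurable_gaussianRatio _ _ _]
  simp_rw [h]

/-- For `r ≥ 1` this is `(r - 2) ^ 2 ≥ 0`. Applied to a likelihood ratio, it bounds the overlap of
two laws below through the second moment. -/
lemma ENNReal.le_min_one_add_sq (r : ℝ≥0∞) : r ≤ min 1 r + 4⁻¹ * r ^ 2 := by
  rcases eq_or_ne r ∞ with rfl | hr
  · simp [ENNReal.mul_top]
  rcases le_total r 1 with h | h
  · rw [min_eq_right h]; exact le_self_add
  · rw [min_eq_left h]
    lift r to ℝ≥0 using hr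
    have : r ≤ 1 + 4⁻¹ * r ^ 2 := by
      rw [← NNReal.coe_le_coe]; push_cast
      nlinarith [sq_nonneg ((r : ℝ) - 2)]
    have h4 : (4⁻¹ : ℝ≥0∞) = ((4⁻¹ : ℝ≥0) : ℝ≥0∞) := by
      rw [ENNReal.coe_inv (by norm_num)]; norm_num
    rw [h4]
    exact_mod_cast this

/-- Le Cam's two point bound: two normal means at distance at most `σ` cannot be told apart. -/
lemma two_point_bound {σ : ℝ≥0} (hσ : 0 < σ) {θ η : ι → ℝ}
    (hdist : ∑ i, (η i - θ i) ^ 2 ≤ (σ : ℝ) ^ 2) {F G : (ι → ℝ) → ℝ≥0∞}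
    (hF : Measurable F) (hG : Measurable G) {A : ℝ≥0∞} (hA : ∀ y, A ≤ F y + G y) :
    4⁻¹ * A ≤ ∫⁻ y, F y ∂(normalMeans σ θ) + ∫⁻ y, G y ∂(normalMeans σ η) := by
  have hv : σ ^ 2 ≠ 0 := by positivity
  set r : (ι → ℝ) → ℝ≥0∞ := fun y => ∏ i, gaussianRatio (σ ^ 2) (θ i) (η i) (y i) with hr
  have hrm : Measurable r := by
    refine Finset.measurable_prod _ fun i _ => ?_
    exact (measurable_gaussianRatio _ _ _).comp (measurable_pi_apply i)
  have h1 : ∫⁻ y, r y ∂(normalMeans σ θ) = 1 := by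
    rw [hr, normalMeans, lintegral_pi_prod _ fun i => measurable_gaussianRatio _ _ _]
    exact Finset.prod_eq_one fun i _ => lintegral_gaussianRatio hv _ _
  have h2 : ∫⁻ y, r y ^ 2 ∂(normalMeans σ θ) ≤ 3 := by
    simp_rw [hr, ← Finset.prod_pow]
    rw [normalMeans, lintegral_pi_prod _ fun i => (measurable_gaussianRatio _ _ _).pow_const 2]
    simp_rw [lintegral_gaussianRatio_sq hv]
    rw [← ENNReal.ofReal_prod_of_nonneg fun i _ => by positivity, ← Real.exp_sum,
      ← Finset.sum_div]
    have hs : (0 : ℝ) < ((σ ^ 2 : ℝ≥0) : ℝ) := by positivity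
    have : (∑ i, (η i - θ i) ^ 2) / ((σ ^ 2 : ℝ≥0) : ℝ) ≤ 1 := by
      rw [div_le_one hs]; simpa using hdist
    calc _ ≤ ENNReal.ofReal 3 := ENNReal.ofReal_le_ofReal
          ((Real.exp_le_exp.2 this).trans (Real.exp_one_lt_d9.le.trans (by norm_num)))
      _ = 3 := by norm_num
  -- The overlap is at least `1 - 3 / 4`, where `3` bounds the second moment `exp 1`.
  have h3 : 4⁻¹ ≤ ∫⁻ y, min 1 (r y) ∂(normalMeans σ θ) := by
    have : (1 : ℝ≥0∞) ≤ ∫⁻ y, min 1 (r y) ∂(normalMeans σ θ) + 4⁻¹ * 3 := by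
      calc (1 : ℝ≥0∞) = ∫⁻ y, r y ∂(normalMeans σ θ) := h1.symm
        _ ≤ ∫⁻ y, min 1 (r y) + 4⁻¹ * r y ^ 2 ∂(normalMeans σ θ) :=
          lintegral_mono fun y => ENNReal.le_min_one_add_sq _
        _ = ∫⁻ y, min 1 (r y) ∂(normalMeans σ θ)
            + 4⁻¹ * ∫⁻ y, r y ^ 2 ∂(normalMeans σ θ) := by
          rw [lintegral_add_left (measurable_const.min hrm), lintegral_const_mul _ (hrm.pow_const 2)]
        _ ≤ _ := by gcongr
    have h4 : (1 : ℝ≥0∞) = 4⁻¹ + 4⁻¹ * 3 := by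
      rw [show (4⁻¹ : ℝ≥0∞) + 4⁻¹ * 3 = 4⁻¹ * 4 by ring, ENNReal.inv_mul_cancel] <;> norm_num
    refine (ENNReal.add_le_add_iff_right ?_).1 (h4.symm.le.trans this)
    exact ENNReal.mul_ne_top (by norm_num) (by norm_num)
  calc 4⁻¹ * A ≤ (∫⁻ y, min 1 (r y) ∂(normalMeans σ θ)) * A := by gcongr
    _ = ∫⁻ y, min 1 (r y) * A ∂(normalMeans σ θ) :=
      (lintegral_mul_const _ (measurable_const.min hrm)).symm
    _ ≤ ∫⁻ y, F y + r y * G y ∂(normalMeans σ θ) := by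
      refine lintegral_mono fun y => ?_
      calc min 1 (r y) * A ≤ min 1 (r y) * (F y + G y) := by gcongr; exact hA y
        _ = min 1 (r y) * F y + min 1 (r y) * G y := mul_add _ _ _
        _ ≤ 1 * F y + r y * G y := by gcongr <;> simp
        _ = _ := by rw [one_mul]
    _ = _ := by
      rw [lintegral_add_left hF, normalMeans_eq_withDensity hσ θ η,
        lintegral_withDensity_eq_lintegral_mul _ hrm hG]
      rfl

/-- Assouad's bound for a hypercube of normal means with disjoint blocks. The block of the
coordinate `i` is `p i`, and the mean vectors are `i ↦ τ (p i) * w i` with signs `τ`. -/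
theorem assouad_bound {β : Type*} [Fintype β] [DecidableEq β] {σ : ℝ≥0}
    (hσ : 0 < σ)
    (p : ι → β) (w : ι → ℝ) (hw : ∀ b, ∑ i with p i = b, w i ^ 2 ≤ (σ : ℝ) ^ 2 / 4)
    {K : Set (ι → ℝ)}
    (hK : ∀ τ : β → ℝ, (∀ b, |τ b| = 1) → (fun i => τ (p i) * w i) ∈ K) :
    ENNReal.ofReal ((∑ i, w i ^ 2) / (4 * Fintype.card ι)) ≤ minimaxRiskOn σ K := by
  classical
  refine le_iInf₂ fun est hest => ?_
  set sgn : Bool → ℝ := fun t => if t then 1 else -1 with hsgn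
  set vec : (β → Bool) → ι → ℝ := fun τ i => sgn (τ (p i)) * w i with hvec
  set Lo : β → Bool → (ι → ℝ) → ℝ≥0∞ :=
    fun b t y => ENNReal.ofReal (∑ i with p i = b, (est y i - sgn t * w i) ^ 2) with hLo
  have hLom : ∀ b t, Measurable (Lo b t) := by
    intro b t
    refine ENNReal.measurable_ofReal.comp (Finset.measurable_sum _ fun i _ => ?_)
    exact (((measurable_pi_apply i).comp hest).sub_const _).pow_const 2
  set I : (β → Bool) → β → ℝ≥0∞ :=
    fun τ b => ∫⁻ y, Lo b (τ b) y ∂(normalMeans σ (vec τ)) with hI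
  set q : β → ℝ := fun b => ∑ i with p i = b, w i ^ 2 with hq
  have hq0 : ∀ b, 0 ≤ q b := fun b => Finset.sum_nonneg fun i _ => sq_nonneg _
  have hrisk : ∀ τ, sqRisk σ est (vec τ) = (Fintype.card ι : ℝ≥0∞)⁻¹ * ∑ b, I τ b := by
    intro τ
    rw [sqRisk, hI, ← lintegral_finsetSum _ fun b _ => hLom b (τ b)]
    congr 1
    refine lintegral_congr fun y => ?_
    rw [hLo, ← ENNReal.ofReal_sum_of_nonneg fun b _ => Finset.sum_nonneg fun i _ => sq_nonneg _,
      ← Finset.sum_fiberwise _ p]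
    congr 1
    refine Finset.sum_congr rfl fun b _ => Finset.sum_congr rfl fun i hi => ?_
    rw [Finset.mem_filter] at hi
    rw [hvec, ← hi.2]
  have hmem : ∀ τ, vec τ ∈ K := by
    intro τ
    refine hK (fun b => sgn (τ b)) fun b => ?_
    rw [hsgn]; dsimp only; split_ifs <;> simp
  let flip : β → (β → Bool) ≃ (β → Bool) := fun b =>
    Function.Involutive.toPerm (fun τ => Function.update τ b (!τ b)) (by
      intro τ; ext c; by_cases h : c = b
      · subst h; simp
      · simp [h])
  have hflip : ∀ b τ, flip b τ = Function.update τ b (!τ b) := fun b τ => rfl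
  -- Flipping the sign of block `b` moves the mean by `2 * w` there, a squared distance of at most
  -- `4 * (σ² / 4)`. No estimate is close to both means, since `(e - w)² + (e + w)² ≥ 2 * w²`.
  have hpair : ∀ b τ, 4⁻¹ * ENNReal.ofReal (2 * q b) ≤ I τ b + I (flip b τ) b := by
    intro b τ
    refine two_point_bound hσ ?_ (hLom _ _) (hLom _ _) fun y => ?_
    · have : ∀ i, (vec (flip b τ) i - vec τ i) ^ 2 = if p i = b then 4 * w i ^ 2 else 0 := by
        intro i
        simp only [hvec, hflip]
        split_ifs with h
        · subst h
          simp only [Function.update_self, hsgn]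
          cases τ (p i) <;> simp <;> ring
        · simp [Function.update_of_ne h]
      simp_rw [this]
      rw [← Finset.sum_filter, ← Finset.mul_sum]
      linarith [hw b]
    · rw [hLo, ← ENNReal.ofReal_add (Finset.sum_nonneg fun i _ => sq_nonneg _)
        (Finset.sum_nonneg fun i _ => sq_nonneg _)]
      refine ENNReal.ofReal_le_ofReal ?_
      rw [hq, ← Finset.sum_add_distrib, Finset.mul_sum]
      refine Finset.sum_le_sum fun i _ => ?_
      rw [hflip, Function.update_self, hsgn]
      cases τ b <;> simp <;> nlinarith [sq_nonneg (est y i)]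
  set M : ℝ≥0∞ := ⨆ θ ∈ K, sqRisk σ est θ with hM
  have hle : ∀ τ, (Fintype.card ι : ℝ≥0∞)⁻¹ * ∑ b, I τ b ≤ M := fun τ => by
    rw [← hrisk]; exact le_iSup₂ (f := fun θ (_ : θ ∈ K) => sqRisk σ est θ) _ (hmem τ)
  -- The supremum is bounded below by the average over all signs. As `flip b` is a bijection, each
  -- loss is counted twice.
  have hsum : ∑ τ : β → Bool, ∑ b, 4⁻¹ * ENNReal.ofReal (2 * q b)
      ≤ 2 * ∑ τ : β → Bool, ∑ b, I τ b := by
    have : 2 * ∑ τ : β → Bool, ∑ b, I τ b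
        = ∑ τ : β → Bool, ∑ b, (I τ b + I (flip b τ) b) := by
      simp_rw [Finset.sum_add_distrib]
      rw [two_mul]
      congr 1
      rw [Finset.sum_comm]
      conv_rhs => rw [Finset.sum_comm]
      refine Finset.sum_congr rfl fun b _ => ?_
      exact ((flip b).sum_comp fun τ => I τ b).symm
    rw [this]
    exact Finset.sum_le_sum fun τ _ => Finset.sum_le_sum fun b _ => hpair b τ
  have hS : ∑ b, 4⁻¹ * ENNReal.ofReal (2 * q b) = ENNReal.ofReal ((∑ i, w i ^ 2) / 2) := by
    rw [← Finset.mul_sum, ← ENNReal.ofReal_sum_of_nonneg fun b _ => by linarith [hq0 b],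
      ← Finset.mul_sum, hq, Finset.sum_fiberwise _ p (fun i => w i ^ 2),
      show (4⁻¹ : ℝ≥0∞) = ENNReal.ofReal 4⁻¹ by
        rw [ENNReal.ofReal_inv_of_pos (by norm_num)]; norm_num,
      ← ENNReal.ofReal_mul (by norm_num)]
    congr 1; ring
  rw [hS, Finset.sum_const, Finset.card_univ, nsmul_eq_mul] at hsum
  have hfin : (Fintype.card (β → Bool) : ℝ≥0∞) ≠ ∞ := by simp
  have hne : (Fintype.card (β → Bool) : ℝ≥0∞) ≠ 0 := by simp
  have key : (Fintype.card (β → Bool) : ℝ≥0∞) *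
      ((Fintype.card ι : ℝ≥0∞)⁻¹ * ENNReal.ofReal ((∑ i, w i ^ 2) / 2))
      ≤ (Fintype.card (β → Bool) : ℝ≥0∞) * (2 * M) := by
    calc _ = (Fintype.card ι : ℝ≥0∞)⁻¹ * ((Fintype.card (β → Bool) : ℝ≥0∞) *
          ENNReal.ofReal ((∑ i, w i ^ 2) / 2)) := by ring
      _ ≤ (Fintype.card ι : ℝ≥0∞)⁻¹ * (2 * ∑ τ : β → Bool, ∑ b, I τ b) := by gcongr
      _ = 2 * ∑ τ : β → Bool, (Fintype.card ι : ℝ≥0∞)⁻¹ * ∑ b, I τ b := by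
        rw [← Finset.mul_sum]; ring
      _ ≤ 2 * ∑ τ : β → Bool, M := by gcongr with τ; exact hle τ
      _ = _ := by rw [Finset.sum_const, Finset.card_univ, nsmul_eq_mul]; ring
  have key2 := (ENNReal.mul_le_mul_iff_right hne hfin).1 key
  rcases Nat.eq_zero_or_pos (Fintype.card ι) with h0 | h0
  · simp [h0]
  have hc : (0 : ℝ) < Fintype.card ι := by exact_mod_cast h0
  have e1 : (Fintype.card ι : ℝ≥0∞)⁻¹ * ENNReal.ofReal ((∑ i, w i ^ 2) / 2)
      = 2 * ENNReal.ofReal ((∑ i, w i ^ 2) / (4 * Fintype.card ι)) := by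
    rw [show (2 : ℝ≥0∞) = ENNReal.ofReal 2 by norm_num, ← ENNReal.ofReal_mul (by norm_num),
      ← ENNReal.ofReal_natCast, ← ENNReal.ofReal_inv_of_pos hc, ← ENNReal.ofReal_mul (by positivity)]
    congr 1; field_simp; ring
  rw [e1] at key2
  exact (ENNReal.mul_le_mul_iff_right (by norm_num) (by norm_num)).1 key2

end TwoPoint

/-! ### Discrete splines through generating polynomials. -/

open Polynomial in
/-- The polynomial `(1 + X + ⋯ + X ^ (h - 1)) ^ (k + 1)`, the coefficients of which are the values
of a discrete spline of degree `k` supported on `(k + 1) * h` points. -/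
noncomputable def splineBump (k h : ℕ) : ℝ[X] := (∑ i ∈ Finset.range h, X ^ i) ^ (k + 1)

section Polynomial

open Polynomial Finset

/-- Multiplication by `X` shifts the coefficients to the right, so a window starting at zero can
only lose terms. It serves for both `|x|` and `x ^ 2`. -/
lemma sum_coeff_X_pow_mul_le {φ : ℝ → ℝ} (h0 : φ 0 = 0) (hφ : ∀ x, 0 ≤ φ x) (P : ℝ[X])
    (o M : ℕ) :
    ∑ j ∈ range M, φ ((X ^ o * P).coeff j) ≤ ∑ j ∈ range M, φ (P.coeff j) := by
  induction o with
  | zero => simp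
  | succ o ih =>
    refine le_trans ?_ ih
    rw [pow_succ', mul_assoc]
    cases M with
    | zero => simp
    | succ M =>
      rw [sum_range_succ', sum_range_succ]
      simp only [coeff_X_mul, coeff_X_mul_zero, h0, add_zero]
      exact le_add_of_nonneg_right (hφ _)

lemma sum_abs_coeff_X_pow_mul_le (P : ℝ[X]) (o M : ℕ) :
    ∑ j ∈ range M, |(X ^ o * P).coeff j| ≤ ∑ j ∈ range M, |P.coeff j| :=
  sum_coeff_X_pow_mul_le abs_zero abs_nonneg P o M

lemma sum_abs_coeff_one_sub_X_pow_le (h r M : ℕ) :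
    ∑ j ∈ range M, |((1 - X ^ h : ℝ[X]) ^ r).coeff j| ≤ 2 ^ r := by
  induction r with
  | zero =>
    simp only [pow_zero, coeff_one]
    rw [sum_congr rfl fun j _ => show |(if j = 0 then (1 : ℝ) else 0)| = if j = 0 then 1 else 0 by
      split_ifs <;> simp, sum_ite_eq']
    split_ifs <;> norm_num
  | succ r ih =>
    rw [pow_succ', sub_mul, one_mul]
    calc _ ≤ ∑ j ∈ range M, (|((1 - X ^ h : ℝ[X]) ^ r).coeff j|
            + |(X ^ h * (1 - X ^ h : ℝ[X]) ^ r).coeff j|) :=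
          sum_le_sum fun j _ => by rw [coeff_sub]; exact abs_sub _ _
      _ ≤ 2 ^ r + 2 ^ r := by
          rw [sum_add_distrib]
          exact add_le_add ih ((sum_abs_coeff_X_pow_mul_le _ _ _).trans ih)
      _ = _ := by ring

lemma sum_abs_coeff_geom_pow_le (h r M : ℕ) :
    ∑ j ∈ range M, |((∑ i ∈ range h, (X : ℝ[X]) ^ i) ^ r).coeff j| ≤ (h : ℝ) ^ r := by
  induction r with
  | zero => simpa using sum_abs_coeff_one_sub_X_pow_le 0 0 M
  | succ r ih =>
    rw [pow_succ', sum_mul]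
    calc _ ≤ ∑ j ∈ range M, ∑ i ∈ range h,
            |(X ^ i * (∑ i ∈ range h, (X : ℝ[X]) ^ i) ^ r).coeff j| :=
          sum_le_sum fun j _ => by rw [finsetSum_coeff]; exact abs_sum_le_sum_abs _ _
      _ ≤ ∑ i ∈ range h, (h : ℝ) ^ r := by
          rw [sum_comm]
          exact sum_le_sum fun i _ => (sum_abs_coeff_X_pow_mul_le _ _ _).trans ih
      _ = _ := by rw [sum_const, card_range, nsmul_eq_mul]; ring

lemma natDegree_splineBump_lt (k : ℕ) {h : ℕ} (hh : 1 ≤ h) :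
    (splineBump k h).natDegree < (k + 1) * h := by
  have h1 : (∑ i ∈ range h, (X : ℝ[X]) ^ i).natDegree ≤ h - 1 :=
    natDegree_sum_le_of_forall_le _ _ fun i hi => by
      rw [natDegree_X_pow]; have := mem_range.1 hi; omega
  calc _ ≤ (k + 1) * (h - 1) := natDegree_pow_le_of_le _ h1
    _ < _ := Nat.mul_lt_mul_of_pos_left (by omega) (by omega)

/-- Cauchy–Schwarz: the coefficients sum to the value `h ^ (k + 1)` at `1`, and lie on `(k + 1) * h`
places. -/
lemma sum_coeff_sq_splineBump_ge (k : ℕ) {h : ℕ} (hh : 1 ≤ h) :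
    (h : ℝ) ^ (2 * k + 1) / (k + 1)
      ≤ ∑ j ∈ range ((k + 1) * h), (splineBump k h).coeff j ^ 2 := by
  have h1 : ∑ j ∈ range ((k + 1) * h), (splineBump k h).coeff j = (h : ℝ) ^ (k + 1) := by
    have := eval_eq_sum_range' (natDegree_splineBump_lt k hh) 1
    simp only [one_pow, mul_one] at this
    rw [← this, splineBump]
    simp [eval_finsetSum]
  have h2 := sq_sum_le_card_mul_sum_sq (s := range ((k + 1) * h))
    (f := fun j => (splineBump k h).coeff j)
  rw [h1, card_range] at h2
  push_cast at h2
  have hh' : (0 : ℝ) < h := by exact_mod_cast hh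
  rw [div_le_iff₀ (by positivity)]
  refine le_of_mul_le_mul_right ?_ hh'
  calc _ = ((h : ℝ) ^ (k + 1)) ^ 2 := by ring
    _ ≤ _ := h2
    _ = _ := by ring

lemma sum_coeff_sq_splineBump_le (k : ℕ) {h : ℕ} (hh : 1 ≤ h) (M : ℕ) :
    ∑ j ∈ range M, (splineBump k h).coeff j ^ 2
      ≤ ∑ j ∈ range ((k + 1) * h), (splineBump k h).coeff j ^ 2 := by
  rcases le_total M ((k + 1) * h) with hM | hM
  · exact sum_le_sum_of_subset_of_nonneg (range_mono hM) fun _ _ _ => sq_nonneg _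
  · refine (sum_subset (range_mono hM) fun j _ hj => ?_).ge
    rw [mem_range, not_lt] at hj
    rw [coeff_eq_zero_of_natDegree_lt ((natDegree_splineBump_lt k hh).trans_le hj),
      zero_pow two_ne_zero]

/-- The degree is below the period `(k + 1) * h`, so the translates by its multiples have disjoint
supports. -/
lemma coeff_X_pow_mul_splineBump (k : ℕ) {h : ℕ} (hh : 1 ≤ h) (c t : ℕ) :
    (X ^ (c * ((k + 1) * h)) * splineBump k h).coeff t
      = if t / ((k + 1) * h) = c then (splineBump k h).coeff (t % ((k + 1) * h)) else 0 := by
  have hL : 0 < (k + 1) * h := by positivity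
  have hdeg := natDegree_splineBump_lt k hh
  generalize (k + 1) * h = L at *
  rw [coeff_X_pow_mul']
  have hdiv := Nat.div_add_mod t L
  by_cases hc : t / L = c
  · subst hc
    rw [if_pos (Nat.div_mul_le_self t L), if_pos rfl]
    congr 1
    rw [mul_comm]; omega
  · rw [if_neg hc]
    split_ifs with hle
    · refine coeff_eq_zero_of_natDegree_lt (hdeg.trans_le ?_)
      have h1 : c ≤ t / L := (Nat.le_div_iff_mul_le hL).2 hle
      have h2 : (c + 1) * L ≤ t := (Nat.le_div_iff_mul_le hL).1 (by omega)
      rw [add_mul, one_mul] at h2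
      omega
    · rfl

lemma sum_range_mul_mod (φ : ℕ → ℝ) (q L : ℕ) :
    ∑ t ∈ range (q * L), φ (t % L) = q * ∑ t ∈ range L, φ t := by
  induction q with
  | zero => simp
  | succ q ih =>
    rw [add_mul, one_mul, sum_range_add, ih, Nat.cast_succ, add_mul, one_mul]
    congr 1
    refine sum_congr rfl fun t ht => ?_
    rw [Nat.add_comm, Nat.add_mul_mod_self_right, Nat.mod_eq_of_lt (mem_range.1 ht)]

lemma diffMat_mulVec (m : ℕ) (c : ℕ → ℝ) (i : Fin (m - 1)) :
    (diffMat m).mulVec (fun j => c j) i = c (i + 1) - c i := by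
  have hi := i.2
  have h : ∀ j : Fin m, diffMat m i j * c j
      = (if j = ⟨i + 1, by omega⟩ then c j else 0) - (if j = ⟨i, by omega⟩ then c j else 0) := by
    intro j
    simp only [diffMat, Matrix.of_apply, Fin.ext_iff]
    split_ifs <;> first | omega | simp
  simp only [Matrix.mulVec, dotProduct, h, sum_sub_distrib, sum_ite_eq', mem_univ, if_true]

/-- A forward difference at `i` is the coefficient of `(1 - X) * P` at `i + 1`, hence the shift by
`r`. Only coefficients of index below `N` enter, so a bump cut off by the end of the grid needs no
separate treatment. -/
lemma diffMatOrder_mulVec_coeff (N r : ℕ) (P : ℝ[X]) (i : Fin (N - r)) :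
    (diffMatOrder N r).mulVec (fun j => P.coeff j) i = ((1 - X) ^ r * P).coeff (i + r) := by
  induction r with
  | zero => simp [diffMatOrder, Matrix.one_mulVec]
  | succ r ih =>
    have h1 : (diffMatOrder N r).mulVec (fun j => P.coeff j)
        = fun j : Fin (N - r) => ((1 - X) ^ r * P).coeff (j + r) := funext ih
    rw [diffMatOrder, ← Matrix.mulVec_mulVec, h1]
    refine (diffMat_mulVec (N - r) (fun j => ((1 - X) ^ r * P).coeff (j + r)) i).trans ?_
    rw [pow_succ', mul_assoc, sub_mul, one_mul, coeff_sub, ← add_assoc, coeff_X_mul]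
    congr 2
    omega

lemma one_sub_X_pow_mul_splineBump (k h o : ℕ) :
    (1 - X) ^ (k + 1) * (X ^ o * splineBump k h) = X ^ o * (1 - X ^ h) ^ (k + 1) := by
  rw [splineBump, ← mul_neg_geom_sum, mul_pow]; ring

lemma sum_abs_diffMatOrder_splineBump_le (k N h o : ℕ) :
    ∑ i, |(diffMatOrder N (k + 1)).mulVec
      (fun j : Fin N => (X ^ o * splineBump k h).coeff j) i| ≤ 2 ^ (k + 1) := by
  simp_rw [diffMatOrder_mulVec_coeff, one_sub_X_pow_mul_splineBump]
  refine (Fin.sum_univ_eq_sum_range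
    (fun i => |(X ^ o * (1 - X ^ h : ℝ[X]) ^ (k + 1)).coeff (i + (k + 1))|) _).trans_le ?_
  refine le_trans ?_ ((sum_abs_coeff_X_pow_mul_le _ o (k + 1 + (N - (k + 1)))).trans
    (sum_abs_coeff_one_sub_X_pow_le h (k + 1) _))
  rw [sum_range_add]
  simp_rw [add_comm (k + 1)]
  exact le_add_of_nonneg_left (sum_nonneg fun _ _ => abs_nonneg _)

end Polynomial

/-! ### Kronecker variation of products and of sums. -/

section Ktv

open Finset

lemma Fintype.sum_fst_mul_snd {α β : Type*} [Fintype α] [Fintype β] (F : α → ℝ) (G : β → ℝ) :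
    ∑ u : α × β, F u.1 * G u.2 = (∑ a, F a) * ∑ b, G b := by
  rw [Fintype.sum_prod_type, Fintype.sum_mul_sum]

/-- A Kronecker product acts on a product vector factor by factor, and the identity factors merely
evaluate. -/
lemma ktvMat_mulVec_prod (k N d : ℕ) (f : Fin d → Fin N → ℝ) (r : KtvRow k N d) :
    (ktvMat k N d).mulVec (fun x => ∏ l, f l (x l)) r
      = (diffMatOrder N (k + 1)).mulVec (f r.1) r.2.1
        * ∏ l : {l : Fin d // l ≠ r.1}, f l (r.2.2 l) := by
  obtain ⟨j, i, z⟩ := r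
  have h1 : ∀ x : Fin d → Fin N, ktvMat k N d ⟨j, i, z⟩ x * ∏ l, f l (x l)
      = (diffMatOrder N (k + 1) i (x j) * f j (x j)) * ∏ l : {l : Fin d // l ≠ j},
        ((1 : Matrix (Fin N) (Fin N) ℝ) (z l) (x l) * f l (x l)) := by
    intro x
    rw [Fintype.prod_eq_mul_prod_subtype_ne (fun l => f l (x l)) j, prod_mul_distrib]
    simp only [ktvMat, Matrix.of_apply]
    ring
  simp only [Matrix.mulVec, dotProduct, h1]
  refine ((Equiv.funSplitAt j (Fin N)).sum_comp
    (fun u : Fin N × ({l : Fin d // l ≠ j} → Fin N) =>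
      (diffMatOrder N (k + 1) i u.1 * f j u.1) * ∏ l : {l : Fin d // l ≠ j},
        ((1 : Matrix (Fin N) (Fin N) ℝ) (z l) (u.2 l) * f l (u.2 l)))).trans ?_
  refine (Fintype.sum_fst_mul_snd (fun t => diffMatOrder N (k + 1) i t * f j t)
    (fun y : {l : Fin d // l ≠ j} → Fin N => ∏ l : {l : Fin d // l ≠ j},
      ((1 : Matrix (Fin N) (Fin N) ℝ) (z l) (y l) * f l (y l)))).trans ?_
  congr 1
  rw [← Fintype.prod_sum
    (fun (l : {l : Fin d // l ≠ j}) (t : Fin N) => (1 : Matrix (Fin N) (Fin N) ℝ) (z l) t * f l t)]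
  refine prod_congr rfl fun l _ => ?_
  simp [Matrix.one_apply]

lemma ktv_prod_le (k N d : ℕ) (f : Fin d → Fin N → ℝ) {A B : ℝ}
    (hA : ∀ l, ∑ i, |(diffMatOrder N (k + 1)).mulVec (f l) i| ≤ A)
    (hf : ∀ l, ∑ t, |f l t| ≤ B) :
    ktv k N d (fun x => ∏ l, f l (x l)) ≤ d * (A * B ^ (d - 1)) := by
  rw [ktv, Fintype.sum_sigma]
  refine (sum_le_card_nsmul univ _ (A * B ^ (d - 1)) fun j _ => ?_).trans
    (by rw [card_univ, Fintype.card_fin, nsmul_eq_mul])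
  simp_rw [ktvMat_mulVec_prod, abs_mul, abs_prod]
  refine (Fintype.sum_fst_mul_snd (fun i => |(diffMatOrder N (k + 1)).mulVec (f j) i|)
    (fun y : {l : Fin d // l ≠ j} → Fin N =>
      ∏ l : {l : Fin d // l ≠ j}, |f l (y l)|)).trans_le ?_
  rw [← Fintype.prod_sum (fun (l : {l : Fin d // l ≠ j}) (t : Fin N) => |f l t|)]
  refine mul_le_mul (hA j) ?_ (prod_nonneg fun l _ => sum_nonneg fun _ _ => abs_nonneg _)
    ((sum_nonneg fun _ _ => abs_nonneg _).trans (hA j))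
  calc ∏ l : {l : Fin d // l ≠ j}, ∑ t, |f l t| ≤ ∏ _l : {l : Fin d // l ≠ j}, B :=
        prod_le_prod (fun l _ => sum_nonneg fun _ _ => abs_nonneg _) fun l _ => hf l
    _ ≤ B ^ (d - 1) := by rw [prod_const, card_univ]; simp

lemma ktv_sum_mul_le {β : Type*} [Fintype β] (k N d : ℕ) (c : β → ℝ)
    (g : β → (Fin d → Fin N) → ℝ) :
    ktv k N d (fun x => ∑ b, c b * g b x) ≤ ∑ b, |c b| * ktv k N d (g b) := by
  have h : ∀ r, (ktvMat k N d).mulVec (fun x => ∑ b, c b * g b x) r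
      = ∑ b, c b * (ktvMat k N d).mulVec (g b) r := by
    intro r
    simp only [Matrix.mulVec, dotProduct, mul_sum]
    rw [sum_comm]
    exact sum_congr rfl fun b _ => sum_congr rfl fun x _ => by ring
  simp only [ktv, h, mul_sum]
  rw [sum_comm]
  refine sum_le_sum fun r _ => (abs_sum_le_sum_abs _ _).trans_eq ?_
  simp_rw [abs_mul]

lemma ktv_const (k N d : ℕ) (c : ℝ) : ktv k N d (fun _ => c) = 0 := by
  have hone : ∀ i, (diffMatOrder N (k + 1)).mulVec (fun _ => 1) i = 0 := by
    intro i
    have h : ∀ r, ∀ i : Fin (N - (r + 1)), (diffMatOrder N (r + 1)).mulVec (fun _ => 1) i = 0 := by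
      intro r
      induction r with
      | zero =>
        intro i
        rw [diffMatOrder, diffMatOrder, Matrix.mul_one]
        simpa using diffMat_mulVec N (fun _ => 1) i
      | succ r ih =>
        intro i
        rw [diffMatOrder, ← Matrix.mulVec_mulVec, funext ih]
        simpa using diffMat_mulVec (N - (r + 1)) (fun _ => 0) i
    exact h k i
  have h : ∀ r, (ktvMat k N d).mulVec (fun _ => c) r = 0 := by
    intro r
    have h1 : (fun _ : Fin d → Fin N => c) = c • fun _ => ∏ _l : Fin d, (1 : ℝ) := by
      ext; simp
    rw [h1, Matrix.mulVec_smul, Pi.smul_apply]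
    refine (congrArg (c • ·) (ktvMat_mulVec_prod k N d (fun _ _ => 1) r)).trans ?_
    rw [hone, zero_mul, smul_zero]
  simp [ktv, h]


open Polynomial in
lemma ktv_splineBump_le (k N d h : ℕ) (o : Fin d → ℕ) :
    ktv k N d (fun x => ∏ l, (X ^ o l * splineBump k h).coeff (x l))
      ≤ d * (2 ^ (k + 1) * ((h : ℝ) ^ (k + 1)) ^ (d - 1)) := by
  have hf : ∀ l, ∑ t : Fin N, |(X ^ o l * splineBump k h).coeff t| ≤ (h : ℝ) ^ (k + 1) := by
    intro l
    refine (Fin.sum_univ_eq_sum_range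
      (fun t => |(X ^ o l * splineBump k h).coeff t|) N).trans_le ?_
    exact (sum_abs_coeff_X_pow_mul_le _ _ _).trans (sum_abs_coeff_geom_pow_le h (k + 1) N)
  have hA := fun l => sum_abs_diffMatOrder_splineBump_le k N h (o l)
  have := ktv_prod_le k N d (fun l (t : Fin N) => (X ^ o l * splineBump k h).coeff t) hA hf
  exact this

end Ktv

/-! ### The three families of hypotheses. -/

section Minimax

open Finset

/-- A single sign on a constant vector suffices. As this costs no variation, the bound holds at
every radius and also covers the degenerate cases of the other two rates. -/
lemma minimaxRiskOn_ktvClass_ge_const (k : ℕ) {N d : ℕ} (hN : 1 ≤ N) {σ : ℝ≥0} (hσ : 0 < σ)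
    {C : ℝ} (hC : 0 ≤ C) :
    ENNReal.ofReal ((σ : ℝ) ^ 2 / 16 * (1 / (N : ℝ) ^ d)) ≤ minimaxRiskOn σ (ktvClass k N d C) := by
  have hn : (0 : ℝ) < (N : ℝ) ^ d := by positivity
  set c : ℝ := √((σ : ℝ) ^ 2 / 4 / (N : ℝ) ^ d) with hc
  have hsum : ∑ _x : Fin d → Fin N, c ^ 2 = (σ : ℝ) ^ 2 / 4 := by
    rw [hc, Real.sq_sqrt (by positivity), sum_const, card_univ, nsmul_eq_mul]
    simp only [Fintype.card_pi, Fintype.card_fin, prod_const, card_univ, Nat.cast_pow]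
    field_simp
  have h := assouad_bound hσ (fun _ : Fin d → Fin N => ()) (fun _ => c)
    (fun _ => by simpa using hsum.le) (K := ktvClass k N d C) fun τ _ => by
      simpa [ktvClass, ktv_const] using hC
  rw [hsum] at h
  refine le_trans (ENNReal.ofReal_le_ofReal (le_of_eq ?_)) h
  simp only [Fintype.card_pi, Fintype.card_fin, prod_const, card_univ, Nat.cast_pow]
  field_simp
  norm_num

lemma ktv_single_le (k N d : ℕ) (z : Fin d → Fin N) :
    ktv k N d (fun x => if z = x then 1 else 0) ≤ d * 2 ^ (k + 1) := by
  -- A spike is a product of bumps with `h = 1`.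
  have h := ktv_splineBump_le k N d 1 (fun l => z l)
  have h1 : (fun x : Fin d → Fin N => if z = x then (1 : ℝ) else 0)
      = fun x => ∏ l, (Polynomial.X ^ (z l : ℕ) * splineBump k 1).coeff (x l) := by
    ext x
    simp only [splineBump, range_one, sum_singleton, pow_zero, one_pow, mul_one,
      Polynomial.coeff_X_pow]
    split_ifs with hz
    · subst hz; simp
    · obtain ⟨l, hl⟩ := Function.ne_iff.1 hz
      refine (prod_eq_zero (mem_univ l) (if_neg fun h => hl (Fin.ext h.symm))).symm
  rw [h1]
  simpa using h

lemma minimaxRiskOn_ktvClass_ge_spikes {k N d : ℕ} {σ : ℝ≥0} (hσ : 0 < σ)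
    {C : ℝ} (S : Finset (Fin d → Fin N)) (hS : #S * (d * 2 ^ (k + 1) * (σ / 2 : ℝ)) ≤ C) :
    ENNReal.ofReal ((σ : ℝ) ^ 2 / 16 * (#S / (N : ℝ) ^ d))
      ≤ minimaxRiskOn σ (ktvClass k N d C) := by
  have h := assouad_bound hσ (fun x : Fin d → Fin N => x)
    (fun x => if x ∈ S then (σ / 2 : ℝ) else 0) (fun z => by
      rw [sum_filter, sum_ite_eq' univ z, if_pos (mem_univ z)]
      split_ifs
      · apply le_of_eq; ring
      · rw [zero_pow two_ne_zero]; positivity) (K := ktvClass k N d C) fun τ hτ => by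
      have h1 : (fun x => τ x * if x ∈ S then (σ / 2 : ℝ) else 0)
          = fun x => ∑ z, (τ z * if z ∈ S then (σ / 2 : ℝ) else 0) * if z = x then 1 else 0 := by
        ext x
        simp only [mul_ite, mul_one, mul_zero, sum_ite_eq', mem_univ, if_true]
      rw [h1, ktvClass, Set.mem_ofPred_eq]
      refine (ktv_sum_mul_le _ _ _ _ _).trans (le_trans ?_ hS)
      calc _ ≤ ∑ z : Fin d → Fin N, if z ∈ S then (d * 2 ^ (k + 1) * (σ / 2 : ℝ)) else 0 := by
            refine sum_le_sum fun z _ => ?_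
            rw [abs_mul, hτ, one_mul]
            split_ifs
            · rw [abs_of_nonneg (by positivity), mul_comm]
              exact mul_le_mul_of_nonneg_right (ktv_single_le k N d z) (by positivity)
            · simp
        _ = _ := by rw [sum_ite_mem, univ_inter, sum_const, nsmul_eq_mul]
  refine le_trans (ENNReal.ofReal_le_ofReal (le_of_eq ?_)) h
  simp only [ite_pow, Fintype.card_pi, Fintype.card_fin, prod_const, card_univ, Nat.cast_pow]
  rw [zero_pow two_ne_zero, sum_ite_mem, univ_inter, sum_const, nsmul_eq_mul]
  ring

/-- The `ℓ₂` mass of a discrete spline bump. -/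
noncomputable def splineMass (k h : ℕ) : ℝ :=
  ∑ j ∈ range ((k + 1) * h), (splineBump k h).coeff j ^ 2

/-- The `m` blocks per axis cover the grid and are all charged to the variation. Only the `N / ((k +
1) * h)` complete ones are credited to the squared norm. -/
lemma minimaxRiskOn_ktvClass_ge_blocks {k N d h m : ℕ} (hh : 1 ≤ h) {σ : ℝ≥0} (hσ : 0 < σ)
    {C a : ℝ} (ha : 0 ≤ a) (hm : N ≤ m * ((k + 1) * h))
    (haT : a ^ 2 * splineMass k h ^ d ≤ (σ : ℝ) ^ 2 / 4)
    (haC : (m : ℝ) ^ d * (a * (d * (2 ^ (k + 1) * ((h : ℝ) ^ (k + 1)) ^ (d - 1)))) ≤ C) :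
    ENNReal.ofReal (a ^ 2 * ((N / ((k + 1) * h) : ℕ) * splineMass k h) ^ d / (4 * (N : ℝ) ^ d))
      ≤ minimaxRiskOn σ (ktvClass k N d C) := by
  have hL : 0 < (k + 1) * h := by positivity
  set ψ : ℕ → ℝ := fun t => (splineBump k h).coeff (t % ((k + 1) * h)) with hψ
  have hlt : ∀ t : Fin N, (t : ℕ) / ((k + 1) * h) < m := fun t =>
    (Nat.div_lt_iff_lt_mul hL).2 (t.2.trans_le hm)
  set p : (Fin d → Fin N) → Fin d → Fin m := fun x l => ⟨x l / ((k + 1) * h), hlt (x l)⟩ with hp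
  set g : (Fin d → Fin m) → (Fin d → Fin N) → ℝ := fun b x =>
    ∏ l, (Polynomial.X ^ ((b l : ℕ) * ((k + 1) * h)) * splineBump k h).coeff (x l) with hg
  have hgp : ∀ b x, g b x = if p x = b then ∏ l, ψ (x l) else 0 := by
    intro b x
    simp only [hg, coeff_X_pow_mul_splineBump k hh]
    split_ifs with hb
    · refine prod_congr rfl fun l _ => ?_
      rw [if_pos]
      rw [← hb]
    · obtain ⟨l, hl⟩ := Function.ne_iff.1 hb
      exact prod_eq_zero (mem_univ l) (if_neg fun h => hl (Fin.ext h))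
  have hsumg : ∀ b, ∑ x, g b x ^ 2 ≤ splineMass k h ^ d := by
    intro b
    simp_rw [hg, ← prod_pow]
    refine (Fintype.prod_sum (fun l (t : Fin N) =>
      (Polynomial.X ^ ((b l : ℕ) * ((k + 1) * h)) * splineBump k h).coeff t ^ 2)).symm.trans_le ?_
    calc _ ≤ ∏ _l : Fin d, splineMass k h := by
          refine prod_le_prod (fun l _ => sum_nonneg fun _ _ => sq_nonneg _) fun l _ => ?_
          refine (Fin.sum_univ_eq_sum_range (fun t => (Polynomial.X ^ ((b l : ℕ) * ((k + 1) * h))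
            * splineBump k h).coeff t ^ 2) N).trans_le ?_
          exact (sum_coeff_X_pow_mul_le (φ := fun x => x ^ 2) (by simp) (fun x => sq_nonneg x)
            _ _ _).trans (sum_coeff_sq_splineBump_le k hh N)
      _ = _ := by simp
  have hA := assouad_bound hσ p (fun x => a * ∏ l, ψ (x l)) (fun b => by
      refine le_trans ?_ haT
      refine le_trans (le_of_eq ?_) (mul_le_mul_of_nonneg_left (hsumg b) (sq_nonneg a))
      rw [sum_filter, mul_sum]
      refine sum_congr rfl fun x _ => ?_
      rw [hgp]
      split_ifs <;> simp [mul_pow]) (K := ktvClass k N d C) fun τ hτ => by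
      have h1 : (fun x => τ (p x) * (a * ∏ l, ψ (x l))) = fun x => ∑ b, (τ b * a) * g b x := by
        ext x
        simp only [hgp, mul_ite, mul_zero, sum_ite_eq, mem_univ, if_true]
        ring
      rw [h1, ktvClass, Set.mem_ofPred_eq]
      refine (ktv_sum_mul_le _ _ _ _ _).trans (le_trans ?_ haC)
      calc _ ≤ ∑ _b : Fin d → Fin m, a * (d * (2 ^ (k + 1) * ((h : ℝ) ^ (k + 1)) ^ (d - 1))) := by
            refine sum_le_sum fun b _ => ?_
            rw [abs_mul, hτ, one_mul, abs_of_nonneg ha]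
            exact mul_le_mul_of_nonneg_left (ktv_splineBump_le k N d h _) ha
        _ = _ := by simp
  refine le_trans (ENNReal.ofReal_le_ofReal ?_) hA
  simp only [Fintype.card_pi, Fintype.card_fin, prod_const, card_univ, Nat.cast_pow]
  refine div_le_div_of_nonneg_right ?_ (by positivity)
  simp_rw [mul_pow a, ← mul_sum, ← prod_pow]
  refine mul_le_mul_of_nonneg_left ?_ (sq_nonneg a)
  rw [← Fintype.prod_sum (fun (_ : Fin d) (t : Fin N) => ψ t ^ 2)]
  rw [prod_const, card_univ, Fintype.card_fin]
  have hT : 0 ≤ splineMass k h := sum_nonneg fun _ _ => sq_nonneg _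
  refine pow_le_pow_left₀ (by positivity) ?_ d
  rw [Fin.sum_univ_eq_sum_range (fun t => ψ t ^ 2), splineMass,
    ← sum_range_mul_mod (fun t => (splineBump k h).coeff t ^ 2)]
  exact sum_le_sum_of_subset_of_nonneg (range_mono (Nat.div_mul_le_self _ _))
    fun _ _ _ => sq_nonneg _

end Minimax

/-! ### Choice of the scale and the rates. -/

section Rates

open Finset

lemma minimaxRiskOn_ktvClass_ge_linear (k d : ℕ) {σ : ℝ≥0} (hσ : 0 < σ) :
    ∃ c : ℝ, 0 < c ∧ ∀ N : ℕ, 1 ≤ N → ∀ C : ℝ, 0 < C → C ≤ (N : ℝ) ^ d →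
      ENNReal.ofReal (c * (C / (N : ℝ) ^ d)) ≤ minimaxRiskOn σ (ktvClass k N d C) := by
  have hσ' : (0 : ℝ) < σ := by exact_mod_cast hσ
  set κ : ℝ := d * 2 ^ (k + 1) * (σ / 2 : ℝ) with hκ
  set c₀ : ℝ := max 1 κ with hc₀
  have h1 : 1 ≤ c₀ := le_max_left _ _
  have h2 : κ ≤ c₀ := le_max_right _ _
  have h0 : 0 < c₀ := by linarith
  refine ⟨(σ : ℝ) ^ 2 / 16 * (1 / (2 * c₀)), by positivity, fun N hN C hC hCn => ?_⟩
  have hn : (0 : ℝ) < (N : ℝ) ^ d := by positivity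
  -- Below `c₀` the bound `1 / n` already dominates. Above it, `⌊C / c₀⌋₊` spikes fit: `c₀ ≥ κ`
  -- keeps the variation within `C`, and `c₀ ≥ 1` keeps their number within `n`.
  rcases lt_or_ge C c₀ with hlt | hge
  · refine le_trans (ENNReal.ofReal_le_ofReal ?_)
      (minimaxRiskOn_ktvClass_ge_const k (d := d) hN hσ hC.le)
    rw [mul_assoc]
    gcongr
    rw [← mul_div_assoc]
    gcongr
    rw [div_mul_eq_mul_div, div_le_one (by positivity)]
    linarith
  · have hfl : (⌊C / c₀⌋₊ : ℝ) ≤ C / c₀ := Nat.floor_le (by positivity)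
    have hone : 1 ≤ C / c₀ := (one_le_div h0).2 hge
    have hfl2 : C / c₀ / 2 ≤ ⌊C / c₀⌋₊ := by
      have h3 := Nat.lt_floor_add_one (C / c₀)
      have h4 : (1 : ℝ) ≤ ⌊C / c₀⌋₊ := by exact_mod_cast (Nat.one_le_floor_iff _).2 hone
      linarith
    have hcard : ⌊C / c₀⌋₊ ≤ #(univ : Finset (Fin d → Fin N)) := by
      have : (⌊C / c₀⌋₊ : ℝ) ≤ (N : ℝ) ^ d := hfl.trans ((div_le_self hC.le h1).trans hCn)
      simp only [card_univ, Fintype.card_pi, Fintype.card_fin, prod_const]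
      exact_mod_cast this
    obtain ⟨S, -, hS⟩ := exists_subset_card_eq hcard
    refine le_trans (ENNReal.ofReal_le_ofReal ?_)
      (minimaxRiskOn_ktvClass_ge_spikes (C := C) hσ S ?_)
    · rw [hS, mul_assoc]
      gcongr
      rw [← mul_div_assoc]
      gcongr
      refine le_trans (le_of_eq ?_) hfl2
      field_simp
    · rw [hS]
      calc _ ≤ C / c₀ * c₀ := by gcongr
        _ = C := by field_simp

/-- The scale is the ceiling of the root `z` of `z ^ p = K * x ^ 2`, with `x = n / C` in the
application. Since `z ≥ 1`, rounding up at most doubles it, whence `2 ^ d`. -/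
lemma exists_scale (d : ℕ) {p : ℕ} (hp : 0 < p) {K x : ℝ} (hK : 1 ≤ K) (hx : 1 ≤ x) :
    ∃ h : ℕ, 1 ≤ h ∧ K * x ^ 2 ≤ (h : ℝ) ^ p ∧
      x⁻¹ ^ (2 * d / p : ℝ) ≤ 2 ^ d * K ^ (d / p : ℝ) / (h : ℝ) ^ d := by
  have hx0 : 0 < x := by linarith
  have hp' : (0 : ℝ) < p := by exact_mod_cast hp
  have hy : 1 ≤ K * x ^ 2 := one_le_mul_of_one_le_of_one_le hK (one_le_pow₀ hx)
  set z : ℝ := (K * x ^ 2) ^ (1 / p : ℝ) with hz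
  have hz1 : 1 ≤ z := Real.one_le_rpow hy (by positivity)
  have hzp : z ^ p = K * x ^ 2 := by
    rw [hz, one_div, Real.rpow_inv_natCast_pow (by positivity) hp.ne']
  have hzd : z ^ d = K ^ (d / p : ℝ) * x ^ (2 * d / p : ℝ) := by
    rw [hz, ← Real.rpow_natCast _ d, ← Real.rpow_mul (by positivity),
      Real.mul_rpow (by positivity) (by positivity), ← Real.rpow_natCast x 2,
      ← Real.rpow_mul hx0.le]
    congr 2
    · ring
    · push_cast; ring
  have hle : z ≤ ⌈z⌉₊ := Nat.le_ceil z
  have hlt : (⌈z⌉₊ : ℝ) ≤ 2 * z := by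
    have := Nat.ceil_lt_add_one (by linarith : 0 ≤ z)
    linarith
  have hc : 1 ≤ ⌈z⌉₊ := Nat.one_le_ceil_iff.2 (by linarith)
  refine ⟨⌈z⌉₊, hc, ?_, ?_⟩
  · rw [← hzp]; gcongr
  · have hc' : (0 : ℝ) < (⌈z⌉₊ : ℝ) ^ d := by positivity
    rw [le_div_iff₀ hc', Real.inv_rpow hx0.le]
    calc _ ≤ (x ^ (2 * d / p : ℝ))⁻¹ * (2 * z) ^ d := by gcongr
      _ = _ := by
        rw [mul_pow, hzd]
        have : 0 < x ^ (2 * d / p : ℝ) := by positivity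
        field_simp

lemma le_two_mul_mul_div {N L : ℕ} (hL : 0 < L) (hLN : L ≤ N) : N ≤ 2 * L * (N / L) := by
  have h1 := Nat.div_add_mod N L
  have h2 := Nat.mod_lt N hL
  have h3 : L * 1 ≤ L * (N / L) := Nat.mul_le_mul_left L (Nat.div_pos hLN hL)
  rw [mul_assoc]
  omega

/-- Bumps on blocks of side `(k + 1) * h` of total Kronecker variation at most `C`. -/
lemma minimaxRiskOn_ktvClass_ge_of_scale {k N d h : ℕ} (hd : 1 ≤ d) (hh : 1 ≤ h)
    (hhN : (k + 1) * h ≤ N) {σ : ℝ≥0} (hσ : 0 < σ) {C : ℝ} (hC : 0 < C)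
    (hscale : 4 ^ d * ((k : ℝ) + 1) ^ d * (σ : ℝ) ^ 2 * (d * 2 ^ (k + 1)) ^ 2 * ((N : ℝ) ^ d / C) ^ 2
      ≤ (h : ℝ) ^ (2 * (k + 1) + d)) :
    ENNReal.ofReal ((σ : ℝ) ^ 2 / 16 * (1 / (2 * (((k : ℝ) + 1) * h)) ^ d))
      ≤ minimaxRiskOn σ (ktvClass k N d C) := by
  have hσ' : (0 : ℝ) < σ := by exact_mod_cast hσ
  have hL : 0 < (k + 1) * h := by positivity
  have hN : (0 : ℝ) < N := by exact_mod_cast hL.trans_le hhN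
  have hh' : (0 : ℝ) < h := by exact_mod_cast hh
  have hT : (h : ℝ) ^ (2 * k + 1) / (k + 1) ≤ splineMass k h := sum_coeff_sq_splineBump_ge k hh
  have hT0 : 0 < splineMass k h := lt_of_lt_of_le (by positivity) hT
  -- The largest amplitude that keeps each bump undetectable.
  set a : ℝ := √((σ : ℝ) ^ 2 / 4 / splineMass k h ^ d) with ha
  have ha2 : a ^ 2 = (σ : ℝ) ^ 2 / 4 / splineMass k h ^ d := Real.sq_sqrt (by positivity)
  have haT : a ^ 2 * splineMass k h ^ d = (σ : ℝ) ^ 2 / 4 := by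
    rw [ha2]; field_simp
  set q := N / ((k + 1) * h) with hq
  have hNq : (N : ℝ) ≤ 2 * (((k : ℝ) + 1) * h) * q := by
    exact_mod_cast le_two_mul_mul_div hL hhN
  have hm : N ≤ (q + 1) * ((k + 1) * h) := by
    have h1 := Nat.div_add_mod N ((k + 1) * h)
    have h2 := Nat.mod_lt N hL
    rw [add_mul, one_mul, mul_comm]
    rw [← hq] at h1
    omega
  have hmle : ((q + 1 : ℕ) : ℝ) ≤ 2 * N / h := by
    have h1 : 1 ≤ q := Nat.div_pos hhN hL
    have h2 : q * ((k + 1) * h) ≤ N := Nat.div_mul_le_self _ _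
    have h3 : (q + 1) * h ≤ 2 * N := by
      calc (q + 1) * h ≤ (2 * q) * ((k + 1) * h) :=
            Nat.mul_le_mul (by omega) (Nat.le_mul_of_pos_left h (by omega))
        _ = 2 * (q * ((k + 1) * h)) := by ring
        _ ≤ 2 * N := by omega
    rw [le_div_iff₀ hh']
    exact_mod_cast h3
  refine le_trans (ENNReal.ofReal_le_ofReal ?_)
    (minimaxRiskOn_ktvClass_ge_blocks hh hσ (Real.sqrt_nonneg _ : 0 ≤ a) hm haT.le ?_)
  · rw [← hq, ← ha, mul_pow (q : ℝ), show a ^ 2 * ((q : ℝ) ^ d * splineMass k h ^ d)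
      = (a ^ 2 * splineMass k h ^ d) * (q : ℝ) ^ d by ring, haT]
    have h1 : (N : ℝ) ^ d ≤ (2 * (((k : ℝ) + 1) * h)) ^ d * (q : ℝ) ^ d := by
      rw [← mul_pow]; gcongr
    rw [show (σ : ℝ) ^ 2 / 4 * (q : ℝ) ^ d / (4 * (N : ℝ) ^ d)
      = (σ : ℝ) ^ 2 / 16 * ((q : ℝ) ^ d / (N : ℝ) ^ d) by field_simp; ring]
    gcongr ?_ * ?_
    rw [div_le_div_iff₀ (by positivity) (by positivity)]
    linarith
  -- The variation budget is checked after squaring, which removes the square root in `a`.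
  · refine (le_abs_self _).trans (abs_le_of_sq_le_sq ?_ hC.le)
    rw [← ha]
    set κ : ℝ := d * 2 ^ (k + 1) with hκ
    have hexp : (h : ℝ) ^ (2 * (k + 1) + d) * (((h : ℝ) ^ (k + 1)) ^ (d - 1)) ^ 2
        = ((h : ℝ) ^ d) ^ 2 * ((h : ℝ) ^ (2 * k + 1)) ^ d := by
      obtain ⟨e, rfl⟩ : ∃ e, d = e + 1 := ⟨d - 1, by omega⟩
      rw [Nat.add_sub_cancel]
      ring
    have hscale' : 4 ^ d * ((k : ℝ) + 1) ^ d * (σ : ℝ) ^ 2 * κ ^ 2 * ((N : ℝ) ^ d) ^ 2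
        ≤ (h : ℝ) ^ (2 * (k + 1) + d) * C ^ 2 := by
      rw [div_pow, ← mul_div_assoc, div_le_iff₀ (by positivity)] at hscale
      exact hscale
    calc _ = (((q + 1 : ℕ) : ℝ) ^ d) ^ 2 * a ^ 2 * (κ * ((h : ℝ) ^ (k + 1)) ^ (d - 1)) ^ 2 := by
          rw [hκ]; ring
      _ ≤ ((2 * N / h) ^ d) ^ 2 * ((σ : ℝ) ^ 2 / ((h : ℝ) ^ (2 * k + 1) / (k + 1)) ^ d)
          * (κ * ((h : ℝ) ^ (k + 1)) ^ (d - 1)) ^ 2 := by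
          rw [ha2]
          gcongr
          linarith [sq_nonneg (σ : ℝ)]
      _ = (4 ^ d * ((k : ℝ) + 1) ^ d * (σ : ℝ) ^ 2 * κ ^ 2 * ((N : ℝ) ^ d) ^ 2)
          * (((h : ℝ) ^ (k + 1)) ^ (d - 1)) ^ 2
          / (((h : ℝ) ^ d) ^ 2 * ((h : ℝ) ^ (2 * k + 1)) ^ d) := by
          rw [div_pow, div_pow, div_pow _ ((k : ℝ) + 1), mul_pow 2, show (4 : ℝ) ^ d = (2 ^ d) ^ 2 by
            rw [← pow_mul, mul_comm d, pow_mul]; norm_num]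
          field_simp
      _ ≤ ((h : ℝ) ^ (2 * (k + 1) + d) * C ^ 2) * (((h : ℝ) ^ (k + 1)) ^ (d - 1)) ^ 2
          / (((h : ℝ) ^ d) ^ 2 * ((h : ℝ) ^ (2 * k + 1)) ^ d) := by gcongr
      _ = C ^ 2 := by
          rw [← hexp]
          field_simp

lemma minimaxRiskOn_ktvClass_ge_nonparametric (k d : ℕ) (hd : 1 ≤ d) {σ : ℝ≥0} (hσ : 0 < σ) :
    ∃ c : ℝ, 0 < c ∧ ∀ N : ℕ, 1 ≤ N → ∀ C : ℝ, 0 < C → C ≤ (N : ℝ) ^ d →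
      ENNReal.ofReal (c * (C / (N : ℝ) ^ d) ^ (2 * d / (2 * (k + 1) + d : ℕ) : ℝ))
        ≤ minimaxRiskOn σ (ktvClass k N d C) := by
  have hσ' : (0 : ℝ) < σ := by exact_mod_cast hσ
  set K : ℝ := max 1 (4 ^ d * ((k : ℝ) + 1) ^ d * (σ : ℝ) ^ 2 * (d * 2 ^ (k + 1)) ^ 2) with hK
  have hK1 : 1 ≤ K := le_max_left _ _
  have hK2 := le_max_right 1 (4 ^ d * ((k : ℝ) + 1) ^ d * (σ : ℝ) ^ 2 * (d * 2 ^ (k + 1)) ^ 2)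
  rw [← hK] at hK2
  set B : ℝ := 2 ^ d * K ^ (d / (2 * (k + 1) + d : ℕ) : ℝ) with hB
  have hB0 : 0 < B := by positivity
  refine ⟨(σ : ℝ) ^ 2 / 16 * (1 / (B * (2 * ((k : ℝ) + 1)) ^ d)), by positivity,
    fun N hN C hC hCn => ?_⟩
  have hn : (0 : ℝ) < (N : ℝ) ^ d := by positivity
  obtain ⟨h, hh, hs, hr⟩ := exists_scale d (p := 2 * (k + 1) + d) (by omega) hK1
    ((one_le_div hC).2 hCn)
  rw [inv_div, ← hB] at hr
  set t := (C / (N : ℝ) ^ d) ^ (2 * d / (2 * (k + 1) + d : ℕ) : ℝ) with ht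
  have hh' : (0 : ℝ) < h := by exact_mod_cast hh
  have hbound : 1 / (B * (2 * ((k : ℝ) + 1)) ^ d) * t ≤ 1 / (2 * (((k : ℝ) + 1) * h)) ^ d := by
    calc _ ≤ 1 / (B * (2 * ((k : ℝ) + 1)) ^ d) * (B / (h : ℝ) ^ d) := by gcongr
      _ = _ := by
        rw [← mul_assoc 2, mul_pow _ (h : ℝ)]
        field_simp
  rw [mul_assoc]
  rcases le_or_gt ((k + 1) * h) N with hle | hlt
  · refine le_trans (ENNReal.ofReal_le_ofReal ?_)
      (minimaxRiskOn_ktvClass_ge_of_scale hd hh hle hσ hC (le_trans ?_ hs))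
    · gcongr
    · gcongr
  -- Here one block is larger than the grid, so `h ^ (-d)` is at most of order `1 / n` and constant
  -- vectors suffice.
  · refine le_trans (ENNReal.ofReal_le_ofReal ?_)
      (minimaxRiskOn_ktvClass_ge_const k (d := d) hN hσ hC.le)
    have hlt' : (N : ℝ) ≤ ((k : ℝ) + 1) * h := by exact_mod_cast hlt.le
    have h2 : (N : ℝ) ≤ 2 * (((k : ℝ) + 1) * h) := hlt'.trans (by nlinarith)
    gcongr
    refine hbound.trans ?_
    gcongr

end Rates

theorem theorem3 (k d : ℕ) (hd : 1 ≤ d) (σ : ℝ≥0) (hσ : 0 < σ)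
    (s : ℝ) (hs : s = ((k : ℝ) + 1) / (d : ℝ)) :
    ∃ c : ℝ, 0 < c ∧ ∀ᶠ N : ℕ in atTop, ∀ n : ℝ, n = (N : ℝ) ^ d →
      ∀ C : ℝ, 0 < C → C ≤ n →
        ENNReal.ofReal (c * (1 / n + C / n + (C / n) ^ (2 / (2 * s + 1)))) ≤
          minimaxRiskOn σ (ktvClass k N d C) := by
  have hσ' : (0 : ℝ) < σ := by exact_mod_cast hσ
  have hd' : (0 : ℝ) < d := by exact_mod_cast hd
  obtain ⟨c₂, hc₂, h₂⟩ := minimaxRiskOn_ktvClass_ge_linear k d hσ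
  obtain ⟨c₃, hc₃, h₃⟩ := minimaxRiskOn_ktvClass_ge_nonparametric k d hd hσ
  have hE : 2 / (2 * s + 1) = (2 * d / (2 * (k + 1) + d : ℕ) : ℝ) := by
    rw [hs]; push_cast; field_simp
  have hc₁ : 0 < (σ : ℝ) ^ 2 / 16 := by positivity
  set c := min ((σ : ℝ) ^ 2 / 16) (min c₂ c₃) with hc
  have hc0 : 0 < c := lt_min hc₁ (lt_min hc₂ hc₃)
  have l₁ : c ≤ (σ : ℝ) ^ 2 / 16 := min_le_left _ _
  have l₂ : c ≤ c₂ := (min_le_right _ _).trans (min_le_left _ _)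
  have l₃ : c ≤ c₃ := (min_le_right _ _).trans (min_le_right _ _)
  refine ⟨c / 3, by positivity, ?_⟩
  filter_upwards [eventually_ge_atTop 1] with N hN n hn C hC hCn
  subst hn
  have hn0 : (0 : ℝ) < (N : ℝ) ^ d := by positivity
  rw [hE]
  set x := 1 / (N : ℝ) ^ d with hx
  set y := C / (N : ℝ) ^ d with hy
  set z := y ^ (2 * d / (2 * (k + 1) + d : ℕ) : ℝ) with hz
  have hx0 : 0 ≤ x := by positivity
  have hy0 : 0 ≤ y := by positivity
  have hz0 : 0 ≤ z := by positivity
  have key : c / 3 * (x + y + z) ≤ max (c * x) (max (c * y) (c * z)) := by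
    have m₁ := le_max_left (c * x) (max (c * y) (c * z))
    have m₂ := (le_max_left (c * y) (c * z)).trans (le_max_right (c * x) _)
    have m₃ := (le_max_right (c * y) (c * z)).trans (le_max_right (c * x) _)
    linarith
  refine (ENNReal.ofReal_le_ofReal key).trans ?_
  rw [ENNReal.ofReal_max, ENNReal.ofReal_max]
  refine max_le ?_ (max_le ?_ ?_)
  · exact (ENNReal.ofReal_le_ofReal (by gcongr)).trans
      (minimaxRiskOn_ktvClass_ge_const k (d := d) hN hσ hC.le)
  · exact (ENNReal.ofReal_le_ofReal (by gcongr)).trans (h₂ N hN C hC hCn)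
  · exact (ENNReal.ofReal_le_ofReal (by gcongr)).trans (h₃ N hN C hC hCn)
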